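/- Let $p$ be a prime and $k$ an algebraically closed field of characteristic $p$. Meromorphic differential forms on $\mathbb P^1_k$ are written $\omega=f(X)\,dX$ with $f\in k(X)$; the order of $\omega$ is $\mathrm{ord}_a(f)$ at $a\in k$ and $\mathrm{ord}_0(f(1/X))-2$ at $\infty$, and $\omega$ is logarithmic if $\omega=dF/F$ for some nonzero $F\in k(X)$. For integers $m,n\ge 1$, a space $L_{m+1,n}$ is an $n$-dimensional $\mathbb F_p$-vector space of meromorphic differential forms on $\mathbb P^1_k$ all of whose nonzero elements are logarithmic, have order $m-1$ at $\infty$, and have no zero outside $\infty$. For an $n$-tuple $\underline a=(a_1,\dots,a_n)$ in a commutative ring of characteristic $p$, let $\Delta_n(\underline a)=\det\big(a_j^{p^{i-1}}\big)_{1\le i,j\le n}$ be its Moore determinant (with $\Delta_0=1$), and let $\underline{\hat a}_i$ be the $(n-1)$-tuple obtained by removing $a_i$. Let $n,\lambda\ge 1$ be integers with $\lambda p^{n-1}\ge 2$. Let $\underline Q=(Q_1,\dots,Q_n)\in k[X]^n$ be an $n$-tuple of polynomials of degree $\lambda$ whose leading coefficients $q_1,\dots,q_n$ satisfy $\Delta_n(\underline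 q)\ne 0$, and set $$\omega_i:=\frac{(-1)^{i-1}\Delta_{n-1}(\underline{\hat Q}_i)}{\Delta_n(\underline Q)}\,dX\qquad(1\le i\le n).$$ Then $\underline Q$ gives rise to a basis of a space $L_{\lambda p^{n-1},n}$, i.e. $(\omega_1,\dots,\omega_n)$ is an $\mathbb F_p$-basis of a space $L_{\lambda p^{n-1},n}$, if and only if $$\Big(\det\big(\underline Q',\underline Q,\underline Q^{p},\dots,\underline Q^{p^{n-2}}\big)\cdot\Delta_n(\underline Q)^{p-2}\Big)^{(p-2)}=1,$$ where $\underline Q'$ and $\underline Q^{p^j}$ are the column vectors of the derivatives and of the $p^j$-th powers of the $Q_i$ (for $n=1$ the first determinant is just $Q_1'$), and the exponent $(p-2)$ denotes the $(p-2)$-th derivative. -/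

import Mathlib

open Polynomial KaehlerDifferential

/-- The Moore determinant `Δ_n(a) = det (a_j ^ (p ^ i))`, with `0 ≤ i, j < n`
(the empty determinant `Δ_0` is `1`). -/
def mooreDet {R : Type*} [CommRing R] (p : ℕ) {n : ℕ} (a : Fin n → R) : R :=
  (Matrix.of fun i j : Fin n => a j ^ p ^ (i : ℕ)).det

/-- The signed Moore determinant of the `(n-1)`-tuple obtained by removing the entry of index `i`.
Indices start at `0` here, so the sign `(-1) ^ i` is the `(-1) ^ (i - 1)` of `1`-based indexing. -/
def mooreMinor {R : Type*} [CommRing R] (p : ℕ) : {n : ℕ} → (Fin n → R) → Fin n → R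
  | 0, _, i => i.elim0
  | _ + 1, a, i => (-1) ^ (i : ℕ) * mooreDet p (i.removeNth a)

/-- The determinant `det (Q', Q, Q ^ p, …, Q ^ (p ^ (n - 2)))` of the `n × n` matrix whose first
column is the derivative of `Q` and whose column of index `j ≥ 1` is `Q ^ (p ^ (j - 1))`
(indices start at `0`). -/
noncomputable def derivMooreDet {k : Type*} [Field k] (p : ℕ) {n : ℕ} (Q : Fin n → k[X]) : k[X] :=
  (Matrix.of fun i j : Fin n =>
    if (j : ℕ) = 0 then derivative (Q i) else Q i ^ p ^ ((j : ℕ) - 1)).det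

/-- Meromorphic differential forms on the projective line over `k`: the Kähler differentials over
`k` of the function field `k(X)`. -/
abbrev MeroForm (k : Type*) [Field k] : Type _ := Ω[RatFunc k⁄k]

namespace MeroForm

/-- The form `dX`. -/
noncomputable def dX (k : Type*) [Field k] : MeroForm k := D k (RatFunc k) RatFunc.X

theorem D_polynomial {k : Type*} [Field k] (f : k[X]) :
    D k (RatFunc k) (algebraMap k[X] (RatFunc k) f) =
      algebraMap k[X] (RatFunc k) (derivative f) • dX k := by
  have h : ∀ g : k[X], algebraMap k[X] (RatFunc k) g = aeval (RatFunc.X : RatFunc k) g := by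
    intro g
    rw [← RatFunc.algebraMap_X, aeval_algebraMap_apply, aeval_X_left_apply]
  rw [h, h, Derivation.map_aeval, dX]

/-- Every meromorphic form is `f dX` for some rational function `f`. -/
theorem exists_eq_smul_dX {k : Type*} [Field k] (ω : MeroForm k) :
    ∃ f : RatFunc k, ω = f • dX k := by
  have hω : ω ∈ Submodule.span (RatFunc k) (Set.range (D k (RatFunc k))) := by
    rw [KaehlerDifferential.span_range_derivation]; trivial
  have hle : Submodule.span (RatFunc k) (Set.range (D k (RatFunc k))) ≤
      Submodule.span (RatFunc k) {dX k} := by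
    rw [Submodule.span_le]
    rintro _ ⟨g, rfl⟩
    rw [← RatFunc.num_div_denom g, Derivation.leibniz_div, D_polynomial, D_polynomial]
    refine Submodule.smul_mem _ _ (Submodule.sub_mem _ ?_ ?_) <;>
      exact Submodule.smul_mem _ _ (Submodule.smul_mem _ _ (Submodule.mem_span_singleton_self _))
  obtain ⟨f, hf⟩ := Submodule.mem_span_singleton.mp (hle hω)
  exact ⟨f, hf.symm⟩

theorem dX_ne_zero (k : Type*) [Field k] : dX k ≠ 0 := by
  have : Algebra.FormallyEtale k[X] (RatFunc k) :=
    Algebra.FormallyEtale.of_isLocalization (nonZeroDivisors k[X])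
  intro h
  have h1 := tensorKaehlerEquivOfFormallyEtale_symm_D_algebraMap k k[X] (RatFunc k) X
  rw [RatFunc.algebraMap_X, show D k (RatFunc k) RatFunc.X = 0 from h, map_zero] at h1
  have h2 := congrArg (fun z => TensorProduct.rid k[X] (RatFunc k)
    ((polynomialEquiv k).toLinearMap.lTensor (RatFunc k) z)) h1
  simp at h2

/-- The rational function `f` such that `ω = f dX`. -/
noncomputable def coeff {k : Type*} [Field k] (ω : MeroForm k) : RatFunc k :=
  Classical.choose (exists_eq_smul_dX ω)

theorem coeff_smul_dX {k : Type*} [Field k] (ω : MeroForm k) : coeff ω • dX k = ω :=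
  (Classical.choose_spec (exists_eq_smul_dX ω)).symm

theorem coeff_unique {k : Type*} [Field k] (f : RatFunc k) : coeff (f • dX k) = f :=
  smul_left_injective _ (dX_ne_zero k) (coeff_smul_dX (f • dX k))

/-- The order of a meromorphic form `ω = f dX` at a point of the projective line `k ∪ {∞}`: it is
`ord_a f` at `a ∈ k`, and `ord_0 f(1/X) - 2 = deg (denominator) - deg (numerator) - 2` at `∞`.
(Meaningful for `ω ≠ 0` only.) -/
noncomputable def order {k : Type*} [Field k] (ω : MeroForm k) : OnePoint k → ℤ
  | OnePoint.some a =>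
      ((coeff ω).num.rootMultiplicity a : ℤ) - ((coeff ω).denom.rootMultiplicity a : ℤ)
  | OnePoint.infty => ((coeff ω).denom.natDegree : ℤ) - ((coeff ω).num.natDegree : ℤ) - 2

/-- A form is logarithmic if it is `dF / F` for some rational function `F`. -/
def IsLogarithmic {k : Type*} [Field k] (ω : MeroForm k) : Prop :=
  ∃ F : RatFunc k, F ≠ 0 ∧ ω = F⁻¹ • D k (RatFunc k) F

end MeroForm

/-- `Ω` is a space `L_{M,n}`, where `M = m + 1` with `m, n ≥ 1`: an `n`-dimensional `𝔽_p`-vector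
space of meromorphic differential forms on the projective line whose nonzero elements are
logarithmic, have order `m - 1 = M - 2` at `∞`, and have no zero outside `∞`. -/
structure IsSpaceL {k : Type*} [Field k] (p : ℕ) [Algebra (ZMod p) k] (M n : ℕ)
    (Ω : Submodule (ZMod p) (MeroForm k)) : Prop where
  two_le : 2 ≤ M
  pos : 1 ≤ n
  finrank_eq : Module.finrank (ZMod p) Ω = n
  isLogarithmic : ∀ ω ∈ Ω, ω ≠ 0 → ω.IsLogarithmic
  order_infty : ∀ ω ∈ Ω, ω ≠ 0 → ω.order OnePoint.infty = (M : ℤ) - 2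
  eq_infty_of_zero : ∀ ω ∈ Ω, ω ≠ 0 → ∀ x : OnePoint k, 0 < ω.order x → x = OnePoint.infty

/-- The `n`-tuple of forms `ω_i = (P_i / P) dX` attached to `Q`, where `P = Δ_n(Q)` and `P_i` is
the signed Moore determinant of `Q` with `Q_i` removed. -/
noncomputable def assocForms {k : Type*} [Field k] (p : ℕ) {n : ℕ} (Q : Fin n → k[X])
    (i : Fin n) : MeroForm k :=
  (algebraMap k[X] (RatFunc k) (mooreMinor p Q i) / algebraMap k[X] (RatFunc k) (mooreDet p Q)) •
    MeroForm.dX k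

/-- The tuple `Q` gives rise to a basis of a space `L_{M,n}`: the forms attached to `Q` are
a basis over `𝔽_p` of some space `L_{M,n}`. -/
def GivesRiseToBasis {k : Type*} [Field k] (p : ℕ) [Algebra (ZMod p) k] (M : ℕ) {n : ℕ}
    (Q : Fin n → k[X]) : Prop :=
  ∃ Ω : Submodule (ZMod p) (MeroForm k), IsSpaceL p M n Ω ∧
    LinearIndependent (ZMod p) (assocForms p Q) ∧
    Submodule.span (ZMod p) (Set.range (assocForms p Q)) = Ω

/-! Write `P = Δ_n(Q)`, `P_j` for the signed minors, `f_j = P_j / P`, and `E = det(Q', Q, Q^p, …)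
P^(p-2)`. A form `f dX` is logarithmic iff `f^(p-1) = -f^p`, the exponent on the left denoting a
derivative (`isLogarithmic_smul_dX_iff`, from Jacobson's formula). The heart is `f_j' = -f_j^p E`
(`ddX_mooreMinor_div`): both sides solve the same linear system, whose matrix is the Moore matrix of
`Q`. As `p`-th powers are constants for `d/dX`, `p - 2` more derivatives give `f_j^(p-1) = -f_j^p
E^(p-2)`. Hence `ω_j` is logarithmic iff the `(p-2)`-th derivative of `E` is `1`, a condition
independent of `j` that passes to `𝔽_p`-combinations. Everything else is automatic: after an
`𝔽_p`-change of basis, a nonzero combination of the `f_j` is an inverse quotient of Moore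
determinants, that is `1/G` with `G` a polynomial of degree `λ p^(n-1)`
(`exists_sum_mooreMinor_mul_eq`). This yields independence, the order at infinity and the absence of
finite zeros. -/

/-! ### Jacobson's formula and logarithmic derivatives. -/

section TwistedDerivation

variable {A R : Type*} [CommRing A] [CommRing R] [Algebra A R]

/-- The homogeneous component of degree `i` in `f` of `(δ + f) ^ m` applied to `1`. -/
def bellComponent (δ : Derivation A R R) (f : R) : ℕ → ℕ → R
  | 0, 0 => 1
  | 0, _ + 1 => 0
  | m + 1, 0 => δ (bellComponent δ f m 0)
  | m + 1, i + 1 => δ (bellComponent δ f m (i + 1)) + f * bellComponent δ f m i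

theorem bellComponent_succ_zero (δ : Derivation A R R) (f : R) (m : ℕ) :
    bellComponent δ f (m + 1) 0 = 0 := by
  induction m with
  | zero => simp [bellComponent]
  | succ m ih => rw [bellComponent, ih, map_zero]

theorem bellComponent_eq_zero (δ : Derivation A R R) (f : R) (m : ℕ) :
    ∀ i, m < i → bellComponent δ f m i = 0 := by
  induction m with
  | zero => rintro (_ | i) hi <;> simp_all [bellComponent]
  | succ m ih =>
    rintro (_ | i) hi
    · omega
    · rw [bellComponent, ih _ (by omega), ih _ (by omega)]; simp

theorem bellComponent_self (δ : Derivation A R R) (f : R) (m : ℕ) :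
    bellComponent δ f m m = f ^ m := by
  induction m with
  | zero => simp [bellComponent]
  | succ m ih => rw [bellComponent, ih, bellComponent_eq_zero _ _ _ _ (by omega)]; simp; ring

theorem iterate_twisted_one (δ : Derivation A R R) (f : R) (m : ℕ) :
    (fun x => δ x + f * x)^[m] 1 = ∑ i ∈ Finset.range (m + 1), bellComponent δ f m i := by
  induction m with
  | zero => simp [bellComponent]
  | succ m ih =>
    rw [Function.iterate_succ_apply', ih, Finset.sum_range_succ' _ (m + 1), map_sum, Finset.mul_sum]
    simp only [bellComponent, Finset.sum_add_distrib]
    rw [Finset.sum_range_succ' (fun i => δ (bellComponent δ f m i)),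
      Finset.sum_range_succ (fun i => δ (bellComponent δ f m (i + 1))),
      bellComponent_eq_zero _ _ m (m + 1) (by omega)]
    simp; ring

/-- The components are the coefficients in `t` of `(δ + t f)^m 1`, and this is the coefficient form
of its `t`-derivative. For `m = p` the binomials kill all but one term on the right. -/
theorem succ_mul_bellComponent (δ : Derivation A R R) (f : R) (m : ℕ) :
    ∀ i : ℕ, ((i : R) + 1) * bellComponent δ f m (i + 1) =
      ∑ r ∈ Finset.range m,
        (m.choose (r + 1) : R) * (δ^[r] f * bellComponent δ f (m - 1 - r) i) := by
  induction m with
  | zero => simp [bellComponent]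
  | succ m ih =>
    intro i
    have hδ : ∀ (a : ℕ) (x : R), δ ((a : R) * x) = a * δ x := fun a x => by
      rw [← nsmul_eq_mul, map_nsmul, nsmul_eq_mul]
    have key : ((i : R) + 1) * bellComponent δ f (m + 1) (i + 1) =
        f * bellComponent δ f m i + ∑ r ∈ Finset.range m, (m.choose (r + 1) : R) *
          (δ^[r + 1] f * bellComponent δ f (m - 1 - r) i +
            δ^[r] f * bellComponent δ f (m - r) i) := by
      have h1 := congrArg δ (ih i)
      have h2 := hδ (i + 1) (bellComponent δ f m (i + 1))
      push_cast at h2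
      rw [h2, map_sum] at h1
      simp only [hδ, Derivation.leibniz, smul_eq_mul] at h1
      rw [bellComponent, mul_add, h1]
      cases i with
      | zero =>
        rw [add_comm]
        congr 1
        · simp
        refine Finset.sum_congr rfl fun r hr => ?_
        have : m - r = (m - 1 - r) + 1 := by have := Finset.mem_range.1 hr; omega
        rw [this, bellComponent, Function.iterate_succ_apply']
        ring
      | succ j =>
        have h3 := ih j
        have : ((j + 1 : ℕ) + 1 : R) * (f * bellComponent δ f m (j + 1)) =
            f * bellComponent δ f m (j + 1) +
              f * (((j : R) + 1) * bellComponent δ f m (j + 1)) := by push_cast; ring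
        rw [this, h3, add_comm, add_assoc, Finset.mul_sum, ← Finset.sum_add_distrib]
        congr 1
        refine Finset.sum_congr rfl fun r hr => ?_
        have : m - r = (m - 1 - r) + 1 := by have := Finset.mem_range.1 hr; omega
        rw [this, bellComponent, Function.iterate_succ_apply']
        ring
    rw [key]
    -- Pascal's rule matches the two shifted sums of `key`.
    simp only [Nat.choose_succ_succ m, Nat.cast_add, add_mul, mul_add, Finset.sum_add_distrib,
      Nat.add_sub_cancel]
    rw [Finset.sum_range_succ' (fun r => (m.choose r : R) * _),
      Finset.sum_range_succ (fun r => (m.choose (r + 1) : R) * _), Nat.choose_succ_self]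
    simp only [Nat.sub_sub, add_comm 1]
    simp
    ring

end TwistedDerivation

/-- Jacobson's formula for `(δ + f) ^ p` in characteristic `p`, applied to `1`. -/
theorem iterate_prime_twisted_one {A K : Type*} [CommRing A] [Field K] [Algebra A K] (p : ℕ)
    [Fact p.Prime] [CharP K p] (δ : Derivation A K K) (f : K) :
    (fun x => δ x + f * x)^[p] 1 = f ^ p + δ^[p - 1] f := by
  have hp : p.Prime := Fact.out
  obtain ⟨q, rfl⟩ : ∃ q, p = q + 1 + 1 := ⟨p - 2, by have := hp.two_le; omega⟩
  have hB : ∀ i : ℕ, ((i : K) + 1) * bellComponent δ f (q + 1 + 1) (i + 1) =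
      δ^[q + 1] f * bellComponent δ f 0 i := fun i => by
    rw [succ_mul_bellComponent, Finset.sum_range_succ, Finset.sum_eq_zero]
    · simp
    · intro r hr
      have := Finset.mem_range.1 hr
      rw [(CharP.cast_eq_zero_iff K (q + 1 + 1) _).2
        (hp.dvd_choose_self (by omega) (by omega)), zero_mul]
  rw [iterate_twisted_one, Finset.sum_range_succ, bellComponent_self, Finset.sum_range_succ',
    bellComponent_succ_zero, Finset.sum_range_succ', Finset.sum_eq_zero]
  · have h : bellComponent δ f (q + 1 + 1) 1 = δ^[q + 1] f := by
      have h := hB 0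
      rw [show bellComponent δ f 0 0 = 1 from rfl] at h
      simpa using h
    rw [zero_add, zero_add, h, add_zero, add_comm, Nat.add_sub_cancel]
  -- Components of degree `2` to `p - 1` vanish: the degree is invertible mod `p`, and `1` has no
  -- component of positive degree.
  · intro i hi
    have hi := Finset.mem_range.1 hi
    have h := hB (i + 1)
    rw [bellComponent, mul_zero] at h
    refine (mul_eq_zero.1 h).resolve_left fun h0 => ?_
    have : ((i + 1 + 1 : ℕ) : K) = 0 := by push_cast at h0 ⊢; exact h0
    rw [CharP.cast_eq_zero_iff K (q + 1 + 1)] at this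
    exact absurd (Nat.le_of_dvd (by omega) this) (by omega)

theorem iterate_derivation_of_eq_mul {A R : Type*} [CommRing A] [CommRing R] [Algebra A R]
    (δ : Derivation A R R) {f F : R} (hF : δ F = f * F) (m : ℕ) :
    δ^[m] F = (fun x => δ x + f * x)^[m] 1 * F := by
  induction m with
  | zero => simp
  | succ m ih =>
    rw [Function.iterate_succ_apply', ih, Function.iterate_succ_apply', Derivation.leibniz, hF,
      smul_eq_mul, smul_eq_mul]
    ring

/-- Over a field with `δ ^ p = 0`, the logarithmic derivatives are the solutions of
`δ ^ (p - 1) f = -f ^ p`. -/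
theorem exists_logDeriv_iff {A K : Type*} [CommRing A] [Field K] [Algebra A K] (p : ℕ)
    [Fact p.Prime] [CharP K p] (δ : Derivation A K K) (hδ : ∀ x, δ^[p] x = 0) (f : K) :
    (∃ F : K, F ≠ 0 ∧ δ F = f * F) ↔ δ^[p - 1] f = -f ^ p := by
  constructor
  · rintro ⟨F, hF0, hF⟩
    have h := iterate_derivation_of_eq_mul δ hF p
    rw [hδ, iterate_prime_twisted_one, eq_comm, mul_eq_zero, or_iff_left hF0] at h
    linear_combination h
  · intro h
    -- `δ - f` is nilpotent on `1`, so its last nonzero iterate `F` satisfies `δ F = f F`.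
    have h1 : (fun x => δ x + -f * x)^[p] 1 = 0 := by
      rw [iterate_prime_twisted_one, iterate_map_neg, h, neg_pow, neg_one_pow_char]
      ring
    classical
    have hex : ∃ j, (fun x => δ x + -f * x)^[j] 1 = 0 := ⟨p, h1⟩
    have h2 := Nat.find_spec hex
    obtain ⟨j, hj⟩ : ∃ j, Nat.find hex = j + 1 := Nat.exists_eq_succ_of_ne_zero fun h0 => by
      rw [h0] at h2; simp at h2
    refine ⟨(fun x => δ x + -f * x)^[j] 1, Nat.find_min hex (by omega), ?_⟩
    rw [hj, Function.iterate_succ_apply'] at h2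
    linear_combination h2

/-! ### The derivation `d/dX` and the criterion for logarithmic forms. -/

namespace MeroForm

variable {k : Type*} [Field k]

/-- The derivation `d/dX` of `k(X)`. -/
noncomputable def ddX (k : Type*) [Field k] : Derivation k (RatFunc k) (RatFunc k) :=
  Derivation.mk'
    { toFun := fun F => coeff (D k (RatFunc k) F)
      map_add' := fun F G => by
        apply smul_left_injective _ (dX_ne_zero k)
        simp only [add_smul, coeff_smul_dX, map_add]
      map_smul' := fun c F => by
        apply smul_left_injective _ (dX_ne_zero k)
        simp only [coeff_smul_dX, Derivation.map_smul, RingHom.id_apply, smul_assoc] }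
    fun F G => by
      apply smul_left_injective _ (dX_ne_zero k)
      simp only [LinearMap.coe_mk, AddHom.coe_mk, coeff_smul_dX, Derivation.leibniz, add_smul,
        smul_assoc]

theorem ddX_smul_dX (F : RatFunc k) : ddX k F • dX k = D k (RatFunc k) F :=
  coeff_smul_dX _

theorem ddX_algebraMap (P : k[X]) :
    ddX k (algebraMap k[X] (RatFunc k) P) = algebraMap k[X] (RatFunc k) (derivative P) := by
  apply smul_left_injective _ (dX_ne_zero k)
  simp only [ddX_smul_dX, D_polynomial]

theorem iterate_ddX_algebraMap (P : k[X]) (m : ℕ) :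
    (ddX k)^[m] (algebraMap k[X] (RatFunc k) P) =
      algebraMap k[X] (RatFunc k) (derivative^[m] P) := by
  induction m with
  | zero => rfl
  | succ m ih => rw [Function.iterate_succ_apply', ih, ddX_algebraMap, Function.iterate_succ_apply']

theorem ddX_pow_mul (p : ℕ) [CharP k p] (g h : RatFunc k) : ddX k (g ^ p * h) = g ^ p * ddX k h := by
  have : CharP (RatFunc k) p := charP_of_injective_algebraMap (algebraMap k (RatFunc k)).injective p
  rw [Derivation.leibniz, Derivation.leibniz_pow]
  simp

theorem iterate_ddX_pow_mul (p : ℕ) [CharP k p] (g h : RatFunc k) (m : ℕ) :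
    (ddX k)^[m] (g ^ p * h) = g ^ p * (ddX k)^[m] h := by
  induction m with
  | zero => rfl
  | succ m ih => rw [Function.iterate_succ_apply', ih, ddX_pow_mul, Function.iterate_succ_apply']

theorem iterate_prime_ddX (p : ℕ) [hp : Fact p.Prime] [CharP k p] (F : RatFunc k) :
    (ddX k)^[p] F = 0 := by
  induction F using RatFunc.induction_on with
  | f N E hE =>
    have hE' : algebraMap k[X] (RatFunc k) E ≠ 0 := RatFunc.algebraMap_ne_zero hE
    -- Making the denominator a `p`-th power, hence a constant, reduces to polynomials, where `p!`
    -- divides a `p`-th derivative.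
    have h : algebraMap k[X] (RatFunc k) N / algebraMap k[X] (RatFunc k) E =
        (algebraMap k[X] (RatFunc k) E)⁻¹ ^ p *
          algebraMap k[X] (RatFunc k) (N * E ^ (p - 1)) := by
      obtain ⟨q, rfl⟩ : ∃ q, p = q + 1 := ⟨p - 1, by have := hp.out.pos; omega⟩
      simp only [map_mul, map_pow, Nat.add_sub_cancel, inv_pow]
      field_simp
      ring
    rw [h, iterate_ddX_pow_mul, iterate_ddX_algebraMap]
    have h0 : derivative^[p] (N * E ^ (p - 1)) = 0 := by
      rw [Polynomial.iterate_derivative_eq_factorial_smul_sum]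
      have : ((p.factorial : ℕ) : k[X]) = 0 :=
        (CharP.cast_eq_zero_iff k[X] p _).2 (Nat.dvd_factorial hp.out.pos le_rfl)
      rw [nsmul_eq_mul, this, zero_mul]
    rw [h0, map_zero, mul_zero]

theorem isLogarithmic_smul_dX_iff (p : ℕ) [Fact p.Prime] [CharP k p] (f : RatFunc k) :
    (f • dX k).IsLogarithmic ↔ (ddX k)^[p - 1] f = -f ^ p := by
  have : CharP (RatFunc k) p := charP_of_injective_algebraMap (algebraMap k (RatFunc k)).injective p
  rw [← exists_logDeriv_iff p (ddX k) (iterate_prime_ddX p) f, IsLogarithmic]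
  refine exists_congr fun F => and_congr_right fun hF => ?_
  rw [← ddX_smul_dX, smul_smul, (smul_left_injective _ (dX_ne_zero k)).eq_iff]
  constructor
  · rintro rfl; field_simp
  · intro h; rw [h]; field_simp

end MeroForm

/-! ### Cofactor identities for Moore determinants. -/

section Moore

variable {R : Type*} [CommRing R] (p : ℕ) {m : ℕ}

theorem sum_mul_mooreMinor (w Q : Fin (m + 1) → R) :
    ∑ j, w j * mooreMinor p Q j =
      (Matrix.of (Fin.cons w fun (i : Fin m) j => Q j ^ p ^ (i : ℕ)) :
        Matrix (Fin (m + 1)) (Fin (m + 1)) R).det := by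
  rw [Matrix.det_succ_row_zero]
  refine Finset.sum_congr rfl fun j _ => ?_
  rw [mooreMinor, mooreDet, mul_left_comm, mul_assoc]
  rfl

theorem sum_pow_mul_mooreMinor_eq_zero (Q : Fin (m + 1) → R) {i : ℕ} (hi : i < m) :
    ∑ j, Q j ^ p ^ i * mooreMinor p Q j = 0 := by
  rw [sum_mul_mooreMinor p (fun j => Q j ^ p ^ i)]
  exact Matrix.det_zero_of_row_eq (Fin.succ_ne_zero ⟨i, hi⟩).symm rfl

theorem mooreDet_eq_sum_pow_mul_mooreMinor (Q : Fin (m + 1) → R) :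
    mooreDet p Q = (-1) ^ m * ∑ j, Q j ^ p ^ m * mooreMinor p Q j := by
  rw [mooreDet, Matrix.det_succ_row _ (Fin.last m), Finset.mul_sum]
  refine Finset.sum_congr rfl fun j _ => ?_
  rw [mooreMinor, mooreDet, pow_add, Fin.val_last]
  have : ((Matrix.of fun i j : Fin (m + 1) => Q j ^ p ^ (i : ℕ)).submatrix (Fin.last m).succAbove
      j.succAbove) = Matrix.of fun i j' : Fin m => j.removeNth Q j' ^ p ^ (i : ℕ) := by
    ext i j'
    simp [Fin.removeNth]
  rw [this]
  simp only [Matrix.of_apply, Fin.val_last]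
  ring

theorem mooreDet_pow [Fact p.Prime] [CharP R p] {n : ℕ} (Q : Fin n → R) :
    mooreDet p Q ^ p = (Matrix.of fun i j : Fin n => Q j ^ p ^ ((i : ℕ) + 1)).det := by
  rw [mooreDet, ← frobenius_def, RingHom.map_det]
  congr 1
  ext i j
  simp [frobenius_def, pow_succ, pow_mul]

/-- Frobenius shifts the exponents in the minors by one, turning them into the cofactors of the
first row of the Moore matrix. -/
theorem sum_mul_mooreMinor_pow [Fact p.Prime] [CharP R p] (Q : Fin (m + 1) → R) :
    ∑ j, Q j * mooreMinor p Q j ^ p = mooreDet p Q := by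
  rw [mooreDet, Matrix.det_succ_row_zero]
  refine Finset.sum_congr rfl fun j _ => ?_
  rw [mooreMinor, mul_pow, mooreDet_pow, ← pow_mul, mul_comm (j : ℕ) p, pow_mul, neg_one_pow_char]
  simp only [Matrix.of_apply, Fin.val_zero, pow_zero, pow_one]
  rw [mul_left_comm, ← mul_assoc]
  rfl

theorem derivMooreDet_eq_sum {k : Type*} [Field k] (Q : Fin (m + 1) → k[X]) :
    derivMooreDet p Q = ∑ j, derivative (Q j) * mooreMinor p Q j := by
  rw [sum_mul_mooreMinor p (fun j => derivative (Q j)), derivMooreDet, ← Matrix.det_transpose]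
  congr 1
  ext i j : 2
  refine Fin.cases ?_ (fun i => ?_) i <;> simp

end Moore

/-! ### The differential equation satisfied by the quotients `P_j / P`. -/

open MeroForm

theorem ddX_mooreMinor_div {k : Type*} [Field k] (p : ℕ) [hp : Fact p.Prime] [CharP k p] {m : ℕ}
    (Q : Fin (m + 1) → k[X]) (hQ : mooreDet p Q ≠ 0) (j : Fin (m + 1)) :
    ddX k (algebraMap k[X] (RatFunc k) (mooreMinor p Q j) /
        algebraMap k[X] (RatFunc k) (mooreDet p Q)) =
      (algebraMap k[X] (RatFunc k) (mooreMinor p Q j) /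
        algebraMap k[X] (RatFunc k) (mooreDet p Q)) ^ p *
      -algebraMap k[X] (RatFunc k) (derivMooreDet p Q * mooreDet p Q ^ (p - 2)) := by
  have : CharP (RatFunc k) p := charP_of_injective_algebraMap (algebraMap k (RatFunc k)).injective p
  set φ := algebraMap k[X] (RatFunc k) with hφ
  have hP : φ (mooreDet p Q) ≠ 0 := RatFunc.algebraMap_ne_zero hQ
  set f : Fin (m + 1) → RatFunc k := fun j => φ (mooreMinor p Q j) / φ (mooreDet p Q) with hf
  set E : RatFunc k := φ (derivMooreDet p Q * mooreDet p Q ^ (p - 2)) with hE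
  have hEP : E * φ (mooreDet p Q) = φ (mooreDet p Q) ^ p * (∑ j, φ (derivative (Q j)) * f j) := by
    have h : φ (mooreDet p Q) ^ p = φ (mooreDet p Q) ^ (p - 2) * φ (mooreDet p Q) ^ 2 := by
      rw [← pow_add, Nat.sub_add_cancel hp.out.two_le]
    rw [hE, derivMooreDet_eq_sum, h]
    simp only [hf, mul_div_assoc', ← Finset.sum_div, ← map_mul, ← map_sum]
    rw [eq_div_iff hP]
    simp only [map_mul, map_pow]
    ring
  -- The `f_j` solve a Moore system with constant right-hand side `(0, …, 0, (-1)^m)`, so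
  -- differentiating it gives `0`.
  have hsum : ∀ i, i ≤ m → ∃ a : k, ∑ j, φ (Q j) ^ p ^ i * f j = algebraMap k (RatFunc k) a := by
    intro i hi
    simp only [hf, mul_div_assoc', ← Finset.sum_div, ← map_mul, ← map_sum, ← map_pow]
    rcases hi.lt_or_eq with hi | rfl
    · exact ⟨0, by rw [sum_pow_mul_mooreMinor_eq_zero p Q hi]; simp⟩
    · refine ⟨(-1) ^ i, ?_⟩
      rw [div_eq_iff hP, mooreDet_eq_sum_pow_mul_mooreMinor p Q]
      simp only [map_pow, map_neg, map_one, map_mul]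
      rw [← mul_assoc, ← mul_pow]
      simp
  -- In row `0`, `∑ Q_j f_j^p = P / P^p` makes the `E` term equal to `∑ Q_j' f_j`. In rows `i ≥ 1`
  -- the coefficients are constants, and the `E` term contains the `p`-th power of the vanishing row
  -- `i - 1` sum.
  have hker : (Matrix.of fun i j : Fin (m + 1) => φ (Q j) ^ p ^ (i : ℕ)).mulVec
      (fun j => ddX k (f j) + f j ^ p * E) = 0 := by
    funext i
    simp only [Matrix.mulVec, dotProduct, Matrix.of_apply, Pi.zero_apply, mul_add,
      Finset.sum_add_distrib]
    obtain ⟨a, ha⟩ := hsum i (by omega)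
    have h1 := congrArg (ddX k) ha
    rw [Derivation.map_algebraMap, map_sum] at h1
    simp only [Derivation.leibniz, smul_eq_mul, Finset.sum_add_distrib] at h1
    refine Fin.cases (fun _ h1 => ?_) (fun i _ h1 => ?_) i ha h1
    · simp only [Fin.val_zero, pow_zero, pow_one, hφ, ddX_algebraMap] at h1 ⊢
      rw [← hφ] at h1 ⊢
      have h2 : ∑ j, φ (Q j) * (f j ^ p * E) = ∑ j, f j * φ (derivative (Q j)) := by
        have h3 := congrArg φ (sum_mul_mooreMinor_pow p Q)
        simp only [map_sum, map_mul, map_pow] at h3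
        have h4 : ∑ j, φ (Q j) * (f j ^ p * E) =
            φ (mooreDet p Q) / φ (mooreDet p Q) ^ p * E := by
          rw [← h3, Finset.sum_div, Finset.sum_mul, h3]
          exact Finset.sum_congr rfl fun j _ => by rw [hf, div_pow]; ring
        rw [h4, div_mul_eq_mul_div, mul_comm _ E, hEP, mul_div_cancel_left₀ _ (pow_ne_zero p hP)]
        exact Finset.sum_congr rfl fun j _ => by ring
      rw [h2]
      exact h1
    · have h2 : ∀ j, ddX k (φ (Q j) ^ p ^ ((i.succ : Fin (m + 1)) : ℕ)) = 0 := fun j => by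
        rw [Fin.val_succ, pow_succ, pow_mul, Derivation.leibniz_pow]
        simp
      have h3 : ∑ j, φ (Q j) ^ p ^ ((i.succ : Fin (m + 1)) : ℕ) * (f j ^ p * E) = 0 := by
        have h4 := congrArg φ (sum_pow_mul_mooreMinor_eq_zero p Q i.2)
        have h5 : ∑ j, φ (Q j) ^ p ^ ((i.succ : Fin (m + 1)) : ℕ) * (f j ^ p * E) =
            (∑ j, φ (Q j) ^ p ^ (i : ℕ) * φ (mooreMinor p Q j)) ^ p *
              (E / φ (mooreDet p Q) ^ p) := by
          rw [sum_pow_char, Finset.sum_mul]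
          refine Finset.sum_congr rfl fun j _ => ?_
          rw [Fin.val_succ, pow_succ, pow_mul, hf]
          simp only [div_pow, mul_pow]
          ring
        rw [h5]
        simp only [map_sum, map_mul, map_pow, map_zero] at h4
        rw [h4, zero_pow hp.out.ne_zero, zero_mul]
      rw [h3, add_zero]
      simpa [h2] using h1
  have hdet : (Matrix.of fun i j : Fin (m + 1) => φ (Q j) ^ p ^ (i : ℕ)).det ≠ 0 := by
    have h : (Matrix.of fun i j : Fin (m + 1) => φ (Q j) ^ p ^ (i : ℕ)) =
        φ.mapMatrix (Matrix.of fun i j : Fin (m + 1) => Q j ^ p ^ (i : ℕ)) := by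
      ext i j; simp
    rw [h, ← RingHom.map_det]
    exact hP
  have := congrFun (Matrix.eq_zero_of_mulVec_eq_zero hdet hker) j
  simp only [Pi.zero_apply] at this
  linear_combination this

theorem iterate_ddX_mooreMinor_div {k : Type*} [Field k] (p : ℕ) [hp : Fact p.Prime] [CharP k p]
    {m : ℕ} (Q : Fin (m + 1) → k[X]) (hQ : mooreDet p Q ≠ 0) (j : Fin (m + 1)) :
    (ddX k)^[p - 1] (algebraMap k[X] (RatFunc k) (mooreMinor p Q j) /
        algebraMap k[X] (RatFunc k) (mooreDet p Q)) =
      -((algebraMap k[X] (RatFunc k) (mooreMinor p Q j) /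
        algebraMap k[X] (RatFunc k) (mooreDet p Q)) ^ p *
      algebraMap k[X] (RatFunc k)
        (derivative^[p - 2] (derivMooreDet p Q * mooreDet p Q ^ (p - 2)))) := by
  have : p - 1 = p - 2 + 1 := by have := hp.out.two_le; omega
  rw [this, Function.iterate_succ_apply, ddX_mooreMinor_div p Q hQ, iterate_ddX_pow_mul,
    iterate_map_neg, iterate_ddX_algebraMap, mul_neg]

/-! ### Moore quotients and `𝔽_p`-linear change of basis. -/

section MooreQuotient

/-- The quotient `Δ_{m+1}(Q_0, …, Q_m) / Δ_m(Q_1, …, Q_m)` of Moore determinants, which up to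
sign is the product of the `Q_0 + v` over all `𝔽_p`-linear combinations `v` of `Q_1, …, Q_m`. -/
def mooreQuotient {R : Type*} [CommRing R] (p : ℕ) : (m : ℕ) → (Fin (m + 1) → R) → R
  | 0, Q => Q 0
  | m + 1, Q => -mooreQuotient p m fun j =>
      Q j.castSucc ^ p - Q (Fin.last (m + 1)) ^ (p - 1) * Q j.castSucc

variable {R : Type*} [CommRing R] (p : ℕ) [hp : Fact p.Prime] [CharP R p]

theorem mooreDet_succ (m : ℕ) (Q : Fin (m + 1) → R) :
    mooreDet p Q = (-1) ^ m * (Q (Fin.last m) * mooreDet p fun j : Fin m =>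
      Q j.castSucc ^ p - Q (Fin.last m) ^ (p - 1) * Q j.castSucc) := by
  set c := Q (Fin.last m) with hc
  have h : mooreDet p Q = (Matrix.of (Fin.cons Q fun (i : Fin m) j =>
      (Q j ^ p - c ^ (p - 1) * Q j) ^ p ^ (i : ℕ)) : Matrix (Fin (m + 1)) (Fin (m + 1)) R).det := by
    -- Subtracting `c^((p-1) p^i)` times row `i` from row `i + 1` clears the last column below its
    -- top entry `c`.
    refine Matrix.det_eq_of_forall_row_eq_smul_add_pred (fun i => (c ^ (p - 1)) ^ p ^ (i : ℕ))
      (fun j => by simp) fun i j => ?_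
    simp only [Matrix.of_apply, Fin.cons_succ, Fin.val_succ, Fin.val_castSucc]
    rw [sub_pow_char_pow, mul_pow, pow_succ', pow_mul]
    ring
  rw [h, Matrix.det_succ_column _ (Fin.last m), Fin.sum_univ_succ, Finset.sum_eq_zero]
  · have : ((Matrix.of (Fin.cons Q fun (i : Fin m) j =>
        (Q j ^ p - c ^ (p - 1) * Q j) ^ p ^ (i : ℕ)) :
          Matrix (Fin (m + 1)) (Fin (m + 1)) R).submatrix (Fin.succAbove 0)
            (Fin.last m).succAbove) = Matrix.of fun (i j : Fin m) =>
        (Q j.castSucc ^ p - c ^ (p - 1) * Q j.castSucc) ^ p ^ (i : ℕ) := by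
      ext i j; simp
    rw [this]
    simp [mooreDet, ← hc, mul_assoc]
  · intro i _
    have : c ^ p - c ^ (p - 1) * c = 0 := by
      rw [← pow_succ, Nat.sub_add_cancel hp.out.one_le, sub_self]
    simp [← hc, this, hp.out.ne_zero]

/-- Both determinants are reduced by the same last entry, which cancels; their sizes differ by one,
whence the minus sign in `mooreQuotient`. -/
theorem mooreDet_eq_mooreQuotient_mul (m : ℕ) (Q : Fin (m + 1) → R) :
    mooreDet p Q = mooreQuotient p m Q * mooreDet p fun j : Fin m => Q j.succ := by
  induction m with
  | zero => simp [mooreDet, mooreQuotient]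
  | succ m ih =>
    rw [mooreDet_succ, ih, mooreDet_succ p m, mooreQuotient, Fin.succ_last]
    simp only [Fin.succ_castSucc, pow_succ]
    ring

theorem sum_algebraMap_mul_pow [Algebra (ZMod p) R] {ι : Type*} [Fintype ι] (c : ι → ZMod p)
    (S : ι → R) (i : ℕ) :
    (∑ r, algebraMap (ZMod p) R (c r) * S r) ^ p ^ i =
      ∑ r, algebraMap (ZMod p) R (c r) * S r ^ p ^ i := by
  rw [sum_pow_char_pow]
  refine Finset.sum_congr rfl fun r _ => ?_
  rw [mul_pow, ← map_pow, ZMod.pow_card_pow]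

theorem mooreDet_sum_mul [Algebra (ZMod p) R] {n : ℕ} (B : Matrix (Fin n) (Fin n) (ZMod p))
    (S : Fin n → R) :
    mooreDet p (fun j => ∑ r, algebraMap (ZMod p) R (B r j) * S r) =
      mooreDet p S * algebraMap (ZMod p) R B.det := by
  rw [RingHom.map_det, mooreDet, mooreDet, ← Matrix.det_mul]
  congr 1
  ext i j
  simp only [Matrix.of_apply, Matrix.mul_apply, sum_algebraMap_mul_pow, RingHom.mapMatrix_apply,
    Matrix.map_apply]
  exact Finset.sum_congr rfl fun r _ => mul_comm _ _

/-- Frobenius fixes the entries of `B`, so the matrix with rows `B 0` and the powers of the new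
tuple factors as (`e_0` above the powers of `S`) times `B`. -/
theorem sum_row_mul_mooreMinor [Algebra (ZMod p) R] {m : ℕ}
    (B : Matrix (Fin (m + 1)) (Fin (m + 1)) (ZMod p)) (S : Fin (m + 1) → R) :
    ∑ j, algebraMap (ZMod p) R (B 0 j) *
        mooreMinor p (fun j => ∑ r, algebraMap (ZMod p) R (B r j) * S r) j =
      (mooreDet p fun j : Fin m => S j.succ) * algebraMap (ZMod p) R B.det := by
  have h : (mooreDet p fun j : Fin m => S j.succ) =
      (Matrix.of (Fin.cons (Pi.single 0 1) fun (i : Fin m) j => S j ^ p ^ (i : ℕ)) :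
        Matrix (Fin (m + 1)) (Fin (m + 1)) R).det := by
    rw [← sum_mul_mooreMinor, Finset.sum_eq_single 0]
    · simp [mooreMinor, Fin.removeNth, mooreDet]
    · intro j _ hj; simp [hj]
    · simp
  rw [h, RingHom.map_det, ← Matrix.det_mul,
    sum_mul_mooreMinor p (fun j => algebraMap (ZMod p) R (B 0 j))]
  congr 1
  ext i j
  refine Fin.cases ?_ (fun i => ?_) i
  · simp [Matrix.mul_apply, Pi.single_apply]
  · simp only [Matrix.of_apply, Fin.cons_succ, Matrix.mul_apply, sum_algebraMap_mul_pow,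
      RingHom.mapMatrix_apply, Matrix.map_apply]
    exact Finset.sum_congr rfl fun r _ => mul_comm _ _

end MooreQuotient

theorem Matrix.exists_row_zero_eq_det_ne_zero {F : Type*} [Field F] {m : ℕ} {v : Fin (m + 1) → F}
    (hv : v ≠ 0) : ∃ B : Matrix (Fin (m + 1)) (Fin (m + 1)) F, B 0 = v ∧ B.det ≠ 0 := by
  obtain ⟨j, hj⟩ := Function.ne_iff.1 hv
  -- Completes `v` by all unit vectors except one at which `v` is nonzero.
  refine ⟨Matrix.of (Fin.cons v fun i => Pi.single (j.succAbove i) 1), rfl, fun h => ?_⟩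
  obtain ⟨w, hw0, hw⟩ := Matrix.exists_mulVec_eq_zero_iff.2 h
  have h1 : ∀ i, i ≠ j → w i = 0 := fun i hi => by
    obtain ⟨i, rfl⟩ := Fin.exists_succAbove_eq hi
    have := congrFun hw i.succ
    simpa [Matrix.mulVec, dotProduct, Pi.single_apply] using this
  have h2 := congrFun hw 0
  simp only [Matrix.mulVec, dotProduct, Matrix.of_apply, Fin.cons_zero, Pi.zero_apply] at h2
  rw [Finset.sum_eq_single j (fun i _ hi => by rw [h1 i hi, mul_zero]) (by simp)] at h2
  refine hw0 (funext fun i => ?_)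
  by_cases hi : i = j
  · rw [hi]; exact (mul_eq_zero.1 h2).resolve_left hj
  · exact h1 i hi

/-! ### Degrees and leading coefficients. -/

section Degree

variable {k : Type*} [Field k] (p : ℕ) [hp : Fact p.Prime]

/-- The quotient is homogeneous of degree `p^m` in the `Q i`, so its top coefficient is the quotient
of the top coefficients. -/
theorem mooreQuotient_natDegree_le_and_coeff (m : ℕ) : ∀ (l : ℕ) (Q : Fin (m + 1) → k[X]),
    (∀ i, (Q i).natDegree ≤ l) → (mooreQuotient p m Q).natDegree ≤ l * p ^ m ∧
      (mooreQuotient p m Q).coeff (l * p ^ m) = mooreQuotient p m fun i => (Q i).coeff l := by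
  induction m with
  | zero => intro l Q hQ; simpa [mooreQuotient] using hQ 0
  | succ m ih =>
    intro l Q hQ
    have e : (p - 1) * l + l = p * l := by
      conv_rhs => rw [← Nat.sub_add_cancel hp.out.one_le]
      ring
    obtain ⟨h1, h2⟩ := ih (p * l) (fun j : Fin (m + 1) =>
      Q j.castSucc ^ p - Q (Fin.last (m + 1)) ^ (p - 1) * Q j.castSucc) fun j => by
        refine (natDegree_sub_le_of_le (natDegree_pow_le_of_le p (hQ _)) ?_).trans (max_self _).le
        rw [← e]
        exact natDegree_mul_le_of_le (natDegree_pow_le_of_le _ (hQ _)) (hQ _)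
    have e' : l * p ^ (m + 1) = p * l * p ^ m := by ring
    rw [e', mooreQuotient, mooreQuotient, natDegree_neg, coeff_neg, h2]
    refine ⟨h1, ?_⟩
    congr 2
    funext j
    have h3 : (Q (Fin.last (m + 1)) ^ (p - 1) * Q j.castSucc).coeff (p * l) =
        (Q (Fin.last (m + 1))).coeff l ^ (p - 1) * (Q j.castSucc).coeff l := by
      rw [← e, coeff_mul_add_eq_of_natDegree_le (natDegree_pow_le_of_le _ (hQ _)) (hQ _),
        coeff_pow_of_natDegree_le (hQ _)]
    rw [coeff_sub, h3, coeff_pow_of_natDegree_le (hQ _)]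

theorem mooreDet_ne_zero_of_coeff [CharP k p] (l : ℕ) : ∀ (n : ℕ) (Q : Fin n → k[X]),
    (∀ i, (Q i).natDegree ≤ l) → mooreDet p (fun i => (Q i).coeff l) ≠ 0 → mooreDet p Q ≠ 0 := by
  intro n
  induction n with
  | zero => intro Q _ _; simp [mooreDet]
  | succ m ih =>
    intro Q hQ h
    rw [mooreDet_eq_mooreQuotient_mul, mul_ne_zero_iff] at h ⊢
    refine ⟨fun h0 => h.1 ?_, ih _ (fun i => hQ _) h.2⟩
    rw [← (mooreQuotient_natDegree_le_and_coeff p m l Q hQ).2, h0, coeff_zero]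

/-- Every nonzero `𝔽_p`-linear combination of the quotients `P_j / P` is the inverse of a
polynomial of degree `l * p ^ m`. -/
theorem exists_sum_mooreMinor_mul_eq [CharP k p] [Algebra (ZMod p) k] {m l : ℕ}
    (Q : Fin (m + 1) → k[X]) (hQ : ∀ i, (Q i).natDegree ≤ l)
    (h : mooreDet p (fun i => (Q i).coeff l) ≠ 0) {c : Fin (m + 1) → ZMod p} (hc : c ≠ 0) :
    ∃ G : k[X], G.natDegree = l * p ^ m ∧ G ≠ 0 ∧
      (∑ j, algebraMap (ZMod p) k[X] (c j) * mooreMinor p Q j) * G = mooreDet p Q := by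
  obtain ⟨B, rfl, hB⟩ := Matrix.exists_row_zero_eq_det_ne_zero hc
  -- With `c` as first row of `B` and `Q = S B`, the combination is `det B · Δ(S_1, …, S_m)` while
  -- `P = det B · Δ(S_0, …, S_m)`; so `G` is the Moore quotient of `S`.
  set S : Fin (m + 1) → k[X] := fun j => ∑ r, algebraMap (ZMod p) k[X] (B⁻¹ r j) * Q r with hS
  have hBB : B⁻¹ * B = 1 := Matrix.nonsing_inv_mul B (isUnit_iff_ne_zero.2 hB)
  have hSQ : (fun j => ∑ r, algebraMap (ZMod p) k[X] (B r j) * S r) = Q := by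
    funext j
    simp only [hS, Finset.mul_sum]
    rw [Finset.sum_comm]
    have : ∀ i, ∑ r, algebraMap (ZMod p) k[X] (B r j) *
        (algebraMap (ZMod p) k[X] (B⁻¹ i r) * Q i) =
        algebraMap (ZMod p) k[X] ((1 : Matrix _ _ (ZMod p)) i j) * Q i := fun i => by
      rw [← hBB, Matrix.mul_apply, map_sum, Finset.sum_mul]
      exact Finset.sum_congr rfl fun r _ => by rw [map_mul]; ring
    simp only [this, Matrix.one_apply]
    simp
  have hCC : ∀ c : ZMod p, algebraMap (ZMod p) k[X] c = C (algebraMap (ZMod p) k c) := fun c => by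
    rw [IsScalarTower.algebraMap_apply (ZMod p) k k[X]]; rfl
  have hSdeg : ∀ j, (S j).natDegree ≤ l := fun j => natDegree_sum_le_of_forall_le _ _ fun r _ => by
    rw [hCC]; exact (natDegree_C_mul_le _ _).trans (hQ r)
  have hScoeff : mooreDet p (fun j => (S j).coeff l) ≠ 0 := by
    have : (fun j => (S j).coeff l) =
        fun j => ∑ r, algebraMap (ZMod p) k (B⁻¹ r j) * (Q r).coeff l := by
      funext j
      simp only [hS, finsetSum_coeff, hCC, coeff_C_mul]
    rw [this, mooreDet_sum_mul]
    refine mul_ne_zero h ?_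
    rw [Matrix.det_nonsing_inv, Ring.inverse_eq_inv', map_inv₀]
    exact inv_ne_zero fun h0 => hB ((algebraMap (ZMod p) k).injective (h0.trans (map_zero _).symm))
  obtain ⟨h1, h2⟩ := mooreQuotient_natDegree_le_and_coeff p m l S hSdeg
  have h3 : mooreQuotient p m (fun i => (S i).coeff l) ≠ 0 := by
    rw [mooreDet_eq_mooreQuotient_mul] at hScoeff
    exact left_ne_zero_of_mul hScoeff
  rw [← h2] at h3
  refine ⟨mooreQuotient p m S, le_antisymm h1 (le_natDegree_of_ne_zero h3),
    fun h0 => h3 (by rw [h0, coeff_zero]), ?_⟩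
  have h4 := sum_row_mul_mooreMinor p B S
  have h5 := mooreDet_sum_mul p B S
  rw [hSQ] at h4 h5
  rw [h4, h5, mooreDet_eq_mooreQuotient_mul p m S]
  ring

end Degree

/-! ### Orders of `dX / G`, combinations of the `ω_j`, and the equivalence. -/

namespace MeroForm

theorem order_inv_smul_dX {k : Type*} [Field k] {G : k[X]} (hG : G ≠ 0) :
    ((algebraMap k[X] (RatFunc k) G)⁻¹ • dX k).order OnePoint.infty = (G.natDegree : ℤ) - 2 ∧
      ∀ a : k, ((algebraMap k[X] (RatFunc k) G)⁻¹ • dX k).order (OnePoint.some a) ≤ 0 := by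
  have hG' : algebraMap k[X] (RatFunc k) G ≠ 0 := RatFunc.algebraMap_ne_zero hG
  set f := (algebraMap k[X] (RatFunc k) G)⁻¹ with hf
  have hmul : f.num * G = f.denom := by
    apply RatFunc.algebraMap_injective k
    have h := RatFunc.num_div_denom f
    rw [div_eq_iff (RatFunc.algebraMap_ne_zero f.denom_ne_zero)] at h
    rw [map_mul, h, hf]
    field_simp
  -- The reduced numerator divides `1`, so there are no finite zeros.
  have hunit : IsUnit f.num := by
    rw [isUnit_iff_dvd_one]
    have := RatFunc.num_div_dvd (1 : k[X]) hG
    rwa [map_one, one_div] at this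
  obtain ⟨c, hc, hcf⟩ := Polynomial.isUnit_iff.1 hunit
  have hc0 : c ≠ 0 := hc.ne_zero
  constructor
  · simp only [order, coeff_unique]
    rw [← hmul, ← hcf, natDegree_C_mul hc0, natDegree_C]
    simp
  · intro a
    simp only [order, coeff_unique]
    rw [← hcf, rootMultiplicity_C]
    simp

end MeroForm

theorem ZMod.smul_eq_val_smul {p : ℕ} [NeZero p] {M : Type*} [AddCommGroup M] [Module (ZMod p) M]
    (c : ZMod p) (x : M) : c • x = c.val • x := by
  rw [← Nat.cast_smul_eq_nsmul (ZMod p), ZMod.natCast_zmod_val]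

theorem sum_smul_assocForms {k : Type*} [Field k] (p : ℕ) [Fact p.Prime]
    [Algebra (ZMod p) k] {n : ℕ} (Q : Fin n → k[X]) (c : Fin n → ZMod p) :
    ∑ j, c j • assocForms p Q j =
      (∑ j, (c j).val • (algebraMap k[X] (RatFunc k) (mooreMinor p Q j) /
        algebraMap k[X] (RatFunc k) (mooreDet p Q))) • dX k := by
  rw [Finset.sum_smul]
  refine Finset.sum_congr rfl fun j _ => ?_
  rw [ZMod.smul_eq_val_smul, assocForms, smul_assoc]

theorem exists_sum_smul_assocForms_eq {k : Type*} [Field k] (p : ℕ) [Fact p.Prime] [CharP k p]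
    [Algebra (ZMod p) k] {m l : ℕ} (Q : Fin (m + 1) → k[X]) (hQ : ∀ i, (Q i).natDegree ≤ l)
    (h : mooreDet p (fun i => (Q i).coeff l) ≠ 0) {c : Fin (m + 1) → ZMod p} (hc : c ≠ 0) :
    ∃ G : k[X], G.natDegree = l * p ^ m ∧ G ≠ 0 ∧
      ∑ j, c j • assocForms p Q j = (algebraMap k[X] (RatFunc k) G)⁻¹ • dX k := by
  obtain ⟨G, hG, hG0, hGQ⟩ := exists_sum_mooreMinor_mul_eq p Q hQ h hc
  refine ⟨G, hG, hG0, ?_⟩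
  have hP : algebraMap k[X] (RatFunc k) (mooreDet p Q) ≠ 0 :=
    RatFunc.algebraMap_ne_zero (mooreDet_ne_zero_of_coeff p l _ Q hQ h)
  have hG' : algebraMap k[X] (RatFunc k) G ≠ 0 := RatFunc.algebraMap_ne_zero hG0
  rw [sum_smul_assocForms]
  congr 1
  have hN : ∑ j, (c j).val • (algebraMap k[X] (RatFunc k) (mooreMinor p Q j) /
        algebraMap k[X] (RatFunc k) (mooreDet p Q)) =
      algebraMap k[X] (RatFunc k) (∑ j, algebraMap (ZMod p) k[X] (c j) * mooreMinor p Q j) /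
        algebraMap k[X] (RatFunc k) (mooreDet p Q) := by
    rw [map_sum, Finset.sum_div]
    refine Finset.sum_congr rfl fun j _ => ?_
    rw [← Algebra.smul_def, ZMod.smul_eq_val_smul, map_nsmul, smul_div_assoc]
  have hNG := congrArg (algebraMap k[X] (RatFunc k)) hGQ
  rw [map_mul] at hNG
  rw [hN, div_eq_iff hP, ← hNG]
  field_simp

/-- The equation `f^(p-1) = -f^p` is additive in `f`, and Frobenius fixes the `𝔽_p`-coefficients. -/
theorem isLogarithmic_sum_smul_assocForms {k : Type*} [Field k] (p : ℕ) [hp : Fact p.Prime]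
    [CharP k p] [Algebra (ZMod p) k] {m : ℕ} (Q : Fin (m + 1) → k[X]) (hQ : mooreDet p Q ≠ 0)
    (h : derivative^[p - 2] (derivMooreDet p Q * mooreDet p Q ^ (p - 2)) = 1)
    (c : Fin (m + 1) → ZMod p) : (∑ j, c j • assocForms p Q j).IsLogarithmic := by
  have : CharP (RatFunc k) p := charP_of_injective_algebraMap (algebraMap k (RatFunc k)).injective p
  have hsum : ∀ (r : ℕ) (g : Fin (m + 1) → RatFunc k),
      (ddX k)^[r] (∑ j, g j) = ∑ j, (ddX k)^[r] (g j) := fun r g => by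
    induction r with
    | zero => rfl
    | succ r ih => simp only [Function.iterate_succ_apply', ih, map_sum]
  rw [sum_smul_assocForms, isLogarithmic_smul_dX_iff p, sum_pow_char, hsum,
    ← Finset.sum_neg_distrib]
  refine Finset.sum_congr rfl fun j _ => ?_
  rw [iterate_map_nsmul, iterate_ddX_mooreMinor_div p Q hQ, h, map_one, mul_one, smul_neg,
    nsmul_eq_mul, nsmul_eq_mul, mul_pow, ← frobenius_def p ((c j).val : RatFunc k), map_natCast]

theorem mainTheorem3 {k : Type*} [Field k] [IsAlgClosed k] (p : ℕ) [Fact p.Prime] [CharP k p]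
    [Algebra (ZMod p) k] (n l : ℕ) (hn : 1 ≤ n) (hl : 1 ≤ l) (hm : 2 ≤ l * p ^ (n - 1))
    (Q : Fin n → k[X]) (hdeg : ∀ i, (Q i).natDegree = l)
    (hlead : mooreDet p (fun i => (Q i).leadingCoeff) ≠ 0) :
    GivesRiseToBasis p (l * p ^ (n - 1)) Q ↔
      derivative^[p - 2] (derivMooreDet p Q * mooreDet p Q ^ (p - 2)) = 1 := by
  obtain ⟨m, rfl⟩ : ∃ m, n = m + 1 := ⟨n - 1, by omega⟩
  rw [Nat.add_sub_cancel] at hm ⊢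
  have hle : ∀ i, (Q i).natDegree ≤ l := fun i => (hdeg i).le
  have hcoeff : mooreDet p (fun i => (Q i).coeff l) ≠ 0 := by
    simpa only [leadingCoeff, hdeg] using hlead
  have hP : mooreDet p Q ≠ 0 := mooreDet_ne_zero_of_coeff p l _ Q hle hcoeff
  have hli : LinearIndependent (ZMod p) (assocForms p Q) := by
    rw [Fintype.linearIndependent_iff]
    intro c hc
    refine congrFun (f := c) (g := 0) ?_
    by_contra hne
    obtain ⟨G, -, hG0, hG⟩ := exists_sum_smul_assocForms_eq p Q hle hcoeff hne
    rw [hc, eq_comm, smul_eq_zero, or_iff_left (dX_ne_zero k), inv_eq_zero] at hG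
    exact RatFunc.algebraMap_ne_zero hG0 hG
  constructor
  · rintro ⟨Ω, hΩ, -, rfl⟩
    -- One logarithmic form suffices, since the condition on `E` does not depend on `j`.
    have hlog := hΩ.isLogarithmic (assocForms p Q 0) (Submodule.subset_span ⟨0, rfl⟩)
      (hli.ne_zero 0)
    have hf : algebraMap k[X] (RatFunc k) (mooreMinor p Q 0) /
        algebraMap k[X] (RatFunc k) (mooreDet p Q) ≠ 0 := fun h0 =>
      hli.ne_zero 0 (by rw [assocForms, h0, zero_smul])
    rw [assocForms, isLogarithmic_smul_dX_iff p, iterate_ddX_mooreMinor_div p Q hP, neg_inj,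
      mul_eq_left₀ (pow_ne_zero p hf)] at hlog
    exact RatFunc.algebraMap_injective k (hlog.trans (map_one _).symm)
  · intro h
    have hspan : ∀ ω ∈ Submodule.span (ZMod p) (Set.range (assocForms p Q)), ω ≠ 0 →
        ω.IsLogarithmic ∧ ∃ G : k[X], G.natDegree = l * p ^ m ∧ G ≠ 0 ∧
          ω = (algebraMap k[X] (RatFunc k) G)⁻¹ • dX k := by
      intro ω hω hω0
      obtain ⟨c, rfl⟩ := (Submodule.mem_span_range_iff_exists_fun _).1 hω
      refine ⟨isLogarithmic_sum_smul_assocForms p Q hP h c,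
        exists_sum_smul_assocForms_eq p Q hle hcoeff fun h0 => hω0 ?_⟩
      simp [h0]
    refine ⟨_, ⟨hm, hn, ?_, fun ω hω hω0 => (hspan ω hω hω0).1, fun ω hω hω0 => ?_,
      fun ω hω hω0 x hx => ?_⟩, hli, rfl⟩
    · rw [finrank_span_eq_card hli, Fintype.card_fin]
    · obtain ⟨-, G, hG, hG0, rfl⟩ := hspan ω hω hω0
      rw [(order_inv_smul_dX hG0).1, hG]
    · obtain ⟨-, G, hG, hG0, rfl⟩ := hspan ω hω hω0
      induction x using OnePoint.rec with
      | infty => rfl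
      | coe a => exact absurd hx ((order_inv_smul_dX hG0).2 a).not_gt
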